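/- For $x\in\mathbb R^d$, $r\in\mathbb R$ and $\boldsymbol Z=(Z_1,\dots,Z_k)$ with $Z_i\in\mathbb R^d$, let $\mathrm{MT}(x,r,\boldsymbol Z)$ be the following semidefinite program over symmetric matrices $X\in\mathbb R^{(1+k+d)\times(1+k+d)}$ with rows and columns indexed by $1,b_1,\dots,b_k,v_1,\dots,v_d$: $$\max\ \sum_{i=1}^k X_{1,b_i}\quad\text{s.t.}\quad X_{1,1}=1,\quad X_{b_i,b_i}=X_{1,b_i}\ (1\le i\le k),\quad \sum_{j=1}^d X_{v_j,v_j}=1,\quad \langle v_{b_i},Z_i-x\rangle\ge X_{b_i,b_i}\,r\ (1\le i\le k),\quad X\succcurlyeq 0,$$ where $v_{b_i}=(X_{b_i,v_1},\dots,X_{b_i,v_d})$. **Lemma.** Let $k,d\ge 1$, $\alpha\ge 0$, $\beta\in\mathbb R$, and let $\boldsymbol Y=(Y_1,\dots,Y_k)$ be i.i.d. random vectors in $\mathbb R^d$ with finite second moments, mean $\mu$ and covariance matrix $\Lambda$, such that for every $v\in\mathbb R^d$ with $\|v\|=1$ $$\mathbb E\big[|\langle v,Y_i-\mu\rangle|^{1+\alpha}\big]\le\beta$$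 (in particular this expectation is finite). Let $r>0$ satisfy $$r\ \ge\ 100\sqrt{\frac{\operatorname{Tr}\Lambda}{k}}+40\,\beta^{\frac1{1+\alpha}}.$$ Then, with probability at least $1-e^{-k/800}$, the optimal value of $\mathrm{MT}(\mu,r,\boldsymbol Y)$ is at most $k/20$. -/

import Mathlib

open MeasureTheory ProbabilityTheory

/-- Index set of the variables of the semidefinite program: the constant index `1`,
one index `b i` for each vector and one index `v j` for each coordinate. -/
inductive MTIndex (k d : ℕ) : Type
  | one : MTIndex k d
  | b : Fin k → MTIndex k d
  | v : Fin d → MTIndex k d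

/-- The feasible solutions of the semidefinite program `MT(x, r, Z)`. -/
structure MTFeasible {k d : ℕ} (x : EuclideanSpace ℝ (Fin d)) (r : ℝ)
    (Z : Fin k → EuclideanSpace ℝ (Fin d))
    (X : Matrix (MTIndex k d) (MTIndex k d) ℝ) : Prop where
  posSemidef : X.PosSemidef
  one_one : X .one .one = 1
  diag_b : ∀ i, X (.b i) (.b i) = X .one (.b i)
  trace_v : ∑ j, X (.v j) (.v j) = 1
  /-- `⟨v_{b_i}, Z_i - x⟩ ≥ X_{b_i, b_i} r`, where `v_{b_i} = (X_{b_i, v_1}, …, X_{b_i, v_d})`. -/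
  inner_ge : ∀ i, X (.b i) (.b i) * r ≤ ∑ j, X (.b i) (.v j) * (Z i j - x j)

/-- The objective `∑ i, X_{1, b_i}` of the semidefinite program. -/
def mtObjective {k d : ℕ} (X : Matrix (MTIndex k d) (MTIndex k d) ℝ) : ℝ :=
  ∑ i, X .one (.b i)

/-- The optimal value of the semidefinite program `MT(x, r, Z)`. It is a supremum over a
set that is bounded above (`mt_bddAbove`) and, for `0 < d`, nonempty (`mt_nonempty`). -/
noncomputable def mtValue {k d : ℕ} (x : EuclideanSpace ℝ (Fin d)) (r : ℝ)
    (Z : Fin k → EuclideanSpace ℝ (Fin d)) : ℝ :=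
  sSup (mtObjective '' {X | MTFeasible x r Z X})

/-- The covariance matrix of a random vector. -/
noncomputable def covMatrix {Ω : Type*} [MeasurableSpace Ω] {d : ℕ}
    (Y : Ω → EuclideanSpace ℝ (Fin d)) (P : Measure Ω) : Matrix (Fin d) (Fin d) ℝ :=
  Matrix.of fun a c => cov[fun ω => Y ω a, fun ω => Y ω c; P]

theorem mt_bddAbove {k d : ℕ} (x : EuclideanSpace ℝ (Fin d)) (r : ℝ)
    (Z : Fin k → EuclideanSpace ℝ (Fin d)) :
    BddAbove (mtObjective '' {X | MTFeasible x r Z X}) := by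
  classical
  refine ⟨k, ?_⟩
  rintro _ ⟨X, hX, rfl⟩
  have h : ∀ i, X .one (.b i) ≤ 1 := by
    intro i
    have hp := (hX.posSemidef.submatrix (![.one, .b i] : Fin 2 → MTIndex k d)).dotProduct_mulVec_nonneg ![1, -1]
    have hs : X (.b i) .one = X .one (.b i) := by
      simpa using hX.posSemidef.1.apply .one (.b i)
    simp [Matrix.mulVec, dotProduct, Fin.sum_univ_two, hX.one_one, hX.diag_b, hs] at hp
    linarith
  calc mtObjective X ≤ ∑ _i : Fin k, (1 : ℝ) := Finset.sum_le_sum fun i _ => h i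
    _ = k := by simp

theorem mt_nonempty {k d : ℕ} (hd : 0 < d) (x : EuclideanSpace ℝ (Fin d)) (r : ℝ)
    (Z : Fin k → EuclideanSpace ℝ (Fin d)) :
    (mtObjective '' {X | MTFeasible x r Z X}).Nonempty := by
  classical
  let w : MTIndex k d → ℝ := fun a => match a with
    | .one => 1
    | .b _ => 0
    | .v j => if j = ⟨0, hd⟩ then 1 else 0
  refine ⟨_, Matrix.vecMulVec w w, ⟨?_, ?_, ?_, ?_, ?_⟩, rfl⟩
  · refine ⟨?_, ?_⟩
    · ext a c; simp [Matrix.vecMulVec_apply, mul_comm]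
    · intro y
      have : (y.sum fun i yi => y.sum fun j yj => star yi * Matrix.vecMulVec w w i j * yj)
          = (y.sum fun i yi => yi * w i) * (y.sum fun i yi => yi * w i) := by
        simp only [Finsupp.sum, Finset.sum_mul_sum, Matrix.vecMulVec_apply, star_trivial]
        exact Finset.sum_congr rfl fun _ _ => Finset.sum_congr rfl fun _ _ => by ring
      rw [this]; exact mul_self_nonneg _
  · simp [Matrix.vecMulVec_apply, w]
  · intro i; simp [Matrix.vecMulVec_apply, w]
  · simp [Matrix.vecMulVec_apply, w]
  · intro i; simp [Matrix.vecMulVec_apply, w]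

/-! The value at i.i.d. data is concentrated around its mean, and the mean is at most `k / 40`.
Changing one sample moves the value by at most one (`mtValue_le_update_add_one`), so McDiarmid's
inequality bounds the probability of a deviation of `k / 40` by `exp (-k / 800)`.

For the mean, write a feasible matrix as a Gram matrix of vectors `u`. The condition `‖u_b‖² = ⟨u_1,
u_b⟩` puts every `u_b` on the sphere of radius 1/2 about `u_1 / 2`. Splitting `u_b` there bounds `r`
times the objective by `‖∑ Z i‖ / 2` plus half the sum of the norms of `q i = ∑ j, Z i j • u_{v_j}`.
Random signs and Khintchine's inequality bound the sum of the norms by twice the supremum over unit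
`v` of `∑ |⟨v, Z i⟩|` (`MTFeasible.mul_objective_le`).

Symmetrization and contraction bound the expected supremum by `k` times the largest mean absolute
marginal, plus twice the expected norm of a sum of independent symmetrized vectors. Lyapunov's
inequality bounds the first term by `k * β ^ (1 / (1 + α))`; orthogonality in L² bounds the norms by
`√(k Tr Λ)`. The two constants in the hypothesis on `r` then give `k / 40`. -/

/-! ### Product measures and McDiarmid's inequality -/

theorem measurePreserving_finCons {E : Type*} [MeasurableSpace E] {n : ℕ}
    (ν : Fin (n + 1) → Measure E) [∀ i, IsProbabilityMeasure (ν i)] :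
    MeasurePreserving (fun p : E × (Fin n → E) => (Fin.cons p.1 p.2 : Fin (n + 1) → E))
      ((ν 0).prod (Measure.pi fun i : Fin n => ν i.succ)) (Measure.pi ν) := by
  have h := (measurePreserving_piFinSuccAbove ν 0).symm
  have h2 : (fun p : E × (Fin n → E) => (Fin.cons p.1 p.2 : Fin (n + 1) → E))
      = (MeasurableEquiv.piFinSuccAbove (fun _ => E) 0).symm := by
    funext p
    simp [MeasurableEquiv.piFinSuccAbove_symm_apply]
    rfl
  rw [h2]
  simpa using h

theorem measurableEmbedding_finCons {E : Type*} [MeasurableSpace E] {n : ℕ} :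
    MeasurableEmbedding
      (fun p : E × (Fin n → E) => (Fin.cons p.1 p.2 : Fin (n + 1) → E)) := by
  have h2 : (fun p : E × (Fin n → E) => (Fin.cons p.1 p.2 : Fin (n + 1) → E))
      = (MeasurableEquiv.piFinSuccAbove (fun _ => E) 0).symm := by
    funext p
    simp [MeasurableEquiv.piFinSuccAbove_symm_apply]
    rfl
  rw [h2]
  exact MeasurableEquiv.measurableEmbedding _

theorem integral_pi_succ {E : Type*} [MeasurableSpace E] {n : ℕ}
    (ν : Fin (n + 1) → Measure E) [∀ i, IsProbabilityMeasure (ν i)]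
    (f : (Fin (n + 1) → E) → ℝ) :
    ∫ z, f z ∂(Measure.pi ν)
      = ∫ p, f (Fin.cons p.1 p.2) ∂((ν 0).prod (Measure.pi fun i : Fin n => ν i.succ)) :=
  ((measurePreserving_finCons ν).integral_comp measurableEmbedding_finCons f).symm

theorem MeasureTheory.Integrable.pi_succ {E : Type*} [MeasurableSpace E] {n : ℕ}
    {ν : Fin (n + 1) → Measure E} [∀ i, IsProbabilityMeasure (ν i)]
    {f : (Fin (n + 1) → E) → ℝ} (hf : Integrable f (Measure.pi ν)) :
    Integrable (fun p : E × (Fin n → E) => f (Fin.cons p.1 p.2))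
      ((ν 0).prod (Measure.pi fun i : Fin n => ν i.succ)) :=
  (measurePreserving_finCons ν).integrable_comp_emb measurableEmbedding_finCons |>.2 hf

/-- Hoeffding's lemma for a function whose oscillation is at most one. -/
theorem integral_exp_le_of_oscillation_le_one {E : Type*} [MeasurableSpace E] (ν : Measure E)
    [IsProbabilityMeasure ν] {g : E → ℝ} (hg : Measurable g)
    (hosc : ∀ y y', g y ≤ g y' + 1) (t : ℝ) :
    ∫ y, Real.exp (t * (g y - ∫ x, g x ∂ν)) ∂ν ≤ Real.exp (t ^ 2 / 8) := by
  have hne : Nonempty E := nonempty_of_isProbabilityMeasure ν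
  obtain ⟨y₀⟩ := id hne
  have hbdd : BddBelow (Set.range g) := ⟨g y₀ - 1, by rintro _ ⟨y, rfl⟩; linarith [hosc y₀ y]⟩
  -- Oscillation at most one places `g` in an interval of length one starting at its infimum, and
  -- the sub-Gaussian parameter is 1/4.
  have h := hasSubgaussianMGF_of_mem_Icc (μ := ν) (X := g) (a := ⨅ y, g y) (b := (⨅ y, g y) + 1)
    hg.aemeasurable (ae_of_all _ fun y => ⟨ciInf_le hbdd y, by
      have : g y - 1 ≤ ⨅ y, g y := le_ciInf fun y' => by linarith [hosc y y']
      linarith⟩)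
  have h2 := h.mgf_le t
  simp only [mgf] at h2
  refine h2.trans (le_of_eq ?_)
  congr 1
  simp
  ring

/-- The exponential moment bound behind **McDiarmid's inequality**. -/
theorem integral_exp_le_of_bounded_differences {E : Type*} [MeasurableSpace E] {n : ℕ}
    (ν : Fin n → Measure E) [∀ i, IsProbabilityMeasure (ν i)] (f : (Fin n → E) → ℝ)
    (hf : Measurable f) (C : ℝ) (hC : ∀ z, |f z| ≤ C)
    (hdiff : ∀ z i y, f z ≤ f (Function.update z i y) + 1) (t : ℝ) :
    ∫ z, Real.exp (t * (f z - ∫ x, f x ∂(Measure.pi ν))) ∂(Measure.pi ν)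
      ≤ Real.exp (n * t ^ 2 / 8) := by
  induction n with
  | zero =>
    have h : ∀ g : (Fin 0 → E) → ℝ, ∫ z, g z ∂(Measure.pi ν) = g default := by
      intro g
      rw [integral_unique]
      simp
    rw [h, h]
    simp
  | succ n ih =>
    set π : Measure (Fin n → E) := Measure.pi fun i : Fin n => ν i.succ with hπ
    have hcons : Measurable fun p : E × (Fin n → E) => f (Fin.cons p.1 p.2) :=
      hf.comp measurableEmbedding_finCons.measurable
    have hint : Integrable (fun p : E × (Fin n → E) => f (Fin.cons p.1 p.2)) ((ν 0).prod π) :=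
      .of_bound hcons.aestronglyMeasurable C (ae_of_all _ fun p => hC _)
    have hsec : ∀ z, Measurable fun y => f (Fin.cons y z) := fun z =>
      hcons.comp (measurable_id.prodMk measurable_const)
    have hseci : ∀ z, Integrable (fun y => f (Fin.cons y z)) (ν 0) := fun z =>
      .of_bound (hsec z).aestronglyMeasurable C (ae_of_all _ fun p => hC _)
    -- Averaging out coordinate 0 keeps the bounded differences, so induction handles `g`; the
    -- fluctuation of `f` about `g` in coordinate 0 costs one factor `exp (t² / 8)`.
    set g : (Fin n → E) → ℝ := fun z => ∫ y, f (Fin.cons y z) ∂(ν 0) with hg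
    have hgm : Measurable g := (hcons.stronglyMeasurable.integral_prod_left').measurable
    have hgC : ∀ z, |g z| ≤ C := fun z => by
      simpa using norm_integral_le_of_norm_le_const (μ := ν 0) (f := fun y => f (Fin.cons y z))
        (ae_of_all _ fun p => hC _)
    have hgd : ∀ z i y, g z ≤ g (Function.update z i y) + 1 := by
      intro z i y
      have : g (Function.update z i y) + 1
          = ∫ x, (f (Fin.cons x (Function.update z i y)) + 1) ∂(ν 0) := by
        rw [integral_add (hseci _) (integrable_const _)]; simp [hg]
      rw [this]
      refine integral_mono (hseci _) ((hseci _).add (integrable_const _)) fun x => ?_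
      have := hdiff (Fin.cons x z) i.succ y
      rwa [← Fin.cons_update] at this
    have hm : ∫ x, f x ∂(Measure.pi ν) = ∫ z, g z ∂π := by
      rw [integral_pi_succ, integral_prod_symm _ hint]
    have hih := ih (fun i => ν i.succ) g hgm hgC hgd
    rw [hm, integral_pi_succ]
    set m := ∫ z, g z ∂π with hmdef
    have hexpint : ∀ {F : Type _} [MeasurableSpace F] (ρ : Measure F) [IsProbabilityMeasure ρ]
        (u : F → ℝ), Measurable u → (∀ x, |u x| ≤ C) →
        Integrable (fun x => Real.exp (t * (u x - m))) ρ := by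
      intro F _ ρ _ u hu huC
      refine .of_bound (by fun_prop) (Real.exp (|t| * (C + |m|))) (ae_of_all _ fun x => ?_)
      rw [Real.norm_eq_abs, Real.abs_exp, Real.exp_le_exp]
      calc t * (u x - m) ≤ |t * (u x - m)| := le_abs_self _
        _ = |t| * |u x - m| := abs_mul _ _
        _ ≤ |t| * (C + |m|) := by
          gcongr
          exact (abs_sub _ _).trans (by linarith [huC x])
    have hI : Integrable (fun p : E × (Fin n → E) => Real.exp (t * (f (Fin.cons p.1 p.2) - m)))
        ((ν 0).prod π) := hexpint _ _ hcons fun _ => hC _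
    rw [integral_prod_symm _ hI]
    calc ∫ z, ∫ y, Real.exp (t * (f (Fin.cons y z) - m)) ∂(ν 0) ∂π
        ≤ ∫ z, Real.exp (t ^ 2 / 8) * Real.exp (t * (g z - m)) ∂π := by
          refine integral_mono hI.integral_prod_right
            ((hexpint _ g hgm hgC).const_mul _) fun z => ?_
          have h1 := integral_exp_le_of_oscillation_le_one (ν 0) (hsec z) (fun y y' => by
            have := hdiff (Fin.cons y z) 0 y'
            rwa [Fin.update_cons_zero] at this) t
          have h2 : ∀ y, Real.exp (t * (f (Fin.cons y z) - m))
              = Real.exp (t * (f (Fin.cons y z) - g z)) * Real.exp (t * (g z - m)) := fun y => by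
            rw [← Real.exp_add]; ring_nf
          simp only [h2, integral_mul_const]
          gcongr
      _ = Real.exp (t ^ 2 / 8) * ∫ z, Real.exp (t * (g z - m)) ∂π := integral_const_mul _ _
      _ ≤ Real.exp (t ^ 2 / 8) * Real.exp (n * t ^ 2 / 8) := by gcongr
      _ = Real.exp ((n + 1 : ℕ) * t ^ 2 / 8) := by
          rw [← Real.exp_add]; push_cast; ring_nf

/-- **McDiarmid's inequality** for a bounded function with differences at most one. -/
theorem measure_ge_le_of_bounded_differences {E : Type*} [MeasurableSpace E] {n : ℕ} (hn : 0 < n)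
    (ν : Fin n → Measure E) [∀ i, IsProbabilityMeasure (ν i)] (f : (Fin n → E) → ℝ)
    (hf : Measurable f) (C : ℝ) (hC : ∀ z, |f z| ≤ C)
    (hdiff : ∀ z i y, f z ≤ f (Function.update z i y) + 1) {s : ℝ} (hs : 0 ≤ s) :
    (Measure.pi ν).real {z | ∫ x, f x ∂(Measure.pi ν) + s ≤ f z} ≤ Real.exp (-2 * s ^ 2 / n) := by
  set m := ∫ x, f x ∂(Measure.pi ν)
  have hn' : (0 : ℝ) < n := by exact_mod_cast hn
  -- `4 * s / n` minimizes the Chernoff exponent `-t s + n t² / 8`.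
  have h := integral_exp_le_of_bounded_differences ν f hf C hC hdiff (4 * s / n)
  have hI : Integrable (fun z => Real.exp ((4 * s / n) * (f z - m))) (Measure.pi ν) := by
    refine .of_bound (by fun_prop) (Real.exp (|4 * s / n| * (C + |m|))) (ae_of_all _ fun x => ?_)
    rw [Real.norm_eq_abs, Real.abs_exp, Real.exp_le_exp]
    calc (4 * s / n) * (f x - m) ≤ |(4 * s / n) * (f x - m)| := le_abs_self _
      _ = |4 * s / n| * |f x - m| := abs_mul _ _
      _ ≤ |4 * s / n| * (C + |m|) := by
        gcongr
        exact (abs_sub _ _).trans (by linarith [hC x])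
  have h2 := measure_ge_le_exp_mul_mgf (μ := Measure.pi ν) (X := fun z => f z - m)
    (t := 4 * s / n) s (by positivity) hI
  have h3 : {z | m + s ≤ f z} = {z | s ≤ f z - m} := by
    ext z; simp only [Set.mem_ofPred_eq]; constructor <;> intro h <;> linarith
  rw [h3]
  refine h2.trans ?_
  calc Real.exp (-(4 * s / n) * s) * mgf (fun z => f z - m) (Measure.pi ν) (4 * s / n)
      ≤ Real.exp (-(4 * s / n) * s) * Real.exp (n * (4 * s / n) ^ 2 / 8) := by
        gcongr; exact h
    _ = Real.exp (-2 * s ^ 2 / n) := by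
        rw [← Real.exp_add]; congr 1; field_simp; ring

/-! ### Random signs and Khintchine's inequality -/

/-- The value `±1` of a sign. -/
def boolSign (b : Bool) : ℝ := if b then 1 else -1

theorem sum_sign_succ {n : ℕ} (F : (Fin (n + 1) → Bool) → ℝ) :
    ∑ ε, F ε = ∑ ε : Fin n → Bool, (F (Fin.cons true ε) + F (Fin.cons false ε)) := by
  rw [← (Fin.consEquiv fun _ => Bool).sum_comp, Fintype.sum_prod_type, Fintype.sum_bool,
    ← Finset.sum_add_distrib]
  rfl

/-- Cross terms cancel between opposite signs: the parallelogram law, one coordinate at a time. -/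
theorem sum_sign_norm_sq {H : Type*} [NormedAddCommGroup H] [InnerProductSpace ℝ H] {n : ℕ}
    (u : Fin n → H) :
    ∑ ε : Fin n → Bool, ‖∑ a, boolSign (ε a) • u a‖ ^ 2 = 2 ^ n * ∑ a, ‖u a‖ ^ 2 := by
  induction n with
  | zero => simp
  | succ n ih =>
    rw [sum_sign_succ]
    have h : ∀ ε : Fin n → Bool,
        ‖∑ a, boolSign ((Fin.cons true ε : Fin (n + 1) → Bool) a) • u a‖ ^ 2
          + ‖∑ a, boolSign ((Fin.cons false ε : Fin (n + 1) → Bool) a) • u a‖ ^ 2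
        = 2 * ‖u 0‖ ^ 2 + 2 * ‖∑ a, boolSign (ε a) • u (Fin.succ a)‖ ^ 2 := by
      intro ε
      simp only [Fin.sum_univ_succ, Fin.cons_zero, Fin.cons_succ, boolSign, if_true,
        Bool.false_eq_true, if_false, one_smul, neg_one_smul]
      rw [norm_add_sq_real, norm_add_sq_real, norm_neg, inner_neg_left]
      ring
    simp only [h, Finset.sum_add_distrib, ← Finset.mul_sum, ih]
    rw [Fin.sum_univ_succ]
    simp
    ring

theorem sum_sign_sq {n : ℕ} (w : Fin n → ℝ) :
    ∑ ε : Fin n → Bool, (∑ a, boolSign (ε a) * w a) ^ 2 = 2 ^ n * ∑ a, w a ^ 2 := by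
  simpa using sum_sign_norm_sq w

/-- Adding both signs of the first term kills its odd powers; the mixed term has coefficient 6 in
the average, which matches `3 (a + b)²`. -/
theorem sum_sign_pow_four_le {n : ℕ} (w : Fin n → ℝ) :
    ∑ ε : Fin n → Bool, (∑ a, boolSign (ε a) * w a) ^ 4 ≤ 2 ^ n * (3 * (∑ a, w a ^ 2) ^ 2) := by
  induction n with
  | zero => simp
  | succ n ih =>
    rw [sum_sign_succ]
    have h : ∀ ε : Fin n → Bool,
        (∑ a, boolSign ((Fin.cons true ε : Fin (n + 1) → Bool) a) * w a) ^ 4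
          + (∑ a, boolSign ((Fin.cons false ε : Fin (n + 1) → Bool) a) * w a) ^ 4
        = 2 * w 0 ^ 4 + 12 * w 0 ^ 2 * (∑ a, boolSign (ε a) * w (Fin.succ a)) ^ 2
          + 2 * (∑ a, boolSign (ε a) * w (Fin.succ a)) ^ 4 := by
      intro ε
      simp only [Fin.sum_univ_succ, Fin.cons_zero, Fin.cons_succ, boolSign, if_true,
        Bool.false_eq_true, if_false]
      ring
    simp only [h, Finset.sum_add_distrib, ← Finset.mul_sum, sum_sign_sq]
    have := ih fun a => w (Fin.succ a)
    rw [Fin.sum_univ_succ]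
    simp only [Finset.sum_const, Finset.card_univ, Fintype.card_fun, Fintype.card_bool,
      Fintype.card_fin, nsmul_eq_mul]
    push_cast
    rw [pow_succ (2 : ℝ) n]
    nlinarith [mul_nonneg (pow_nonneg (zero_le_two (α := ℝ)) n) (sq_nonneg (w 0 ^ 2))]

/-- A **Khintchine inequality**, with constant `1 / 2`. -/
theorem sum_sign_abs_ge {n : ℕ} (w : EuclideanSpace ℝ (Fin n)) :
    2 ^ n * (‖w‖ / 2) ≤ ∑ ε : Fin n → Bool, |∑ a, boolSign (ε a) * w a| := by
  rcases (norm_nonneg w).eq_or_lt with h0 | h0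
  · rw [← h0]
    simpa using Finset.sum_nonneg fun _ _ => abs_nonneg _
  have hw : ∑ a, w a ^ 2 = ‖w‖ ^ 2 := by
    rw [EuclideanSpace.norm_sq_eq]; simp
  have h2 := sum_sign_sq w
  have h4 := sum_sign_pow_four_le w
  rw [hw] at h2 h4
  set σ := ‖w‖
  -- This is `|s| (|s| - 2σ)² (|s| + 4σ) ≥ 0` expanded. Averaged, with second moment `σ²` and fourth
  -- moment at most `3σ⁴`, it gives a first moment of at least `9σ / 16`.
  have hp : ∀ s : ℝ, 12 * σ ^ 2 * s ^ 2 - s ^ 4 ≤ 16 * σ ^ 3 * |s| := by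
    intro s
    rw [← sq_abs s, ← Even.pow_abs (by decide : Even 4) s]
    nlinarith [mul_nonneg (abs_nonneg s) (mul_nonneg (sq_nonneg (|s| - 2 * σ))
      (by positivity : 0 ≤ |s| + 4 * σ))]
  have hsum := Finset.sum_le_sum fun (ε : Fin n → Bool) (_ : ε ∈ Finset.univ) =>
    hp (∑ a, boolSign (ε a) * w a)
  rw [Finset.sum_sub_distrib, ← Finset.mul_sum, ← Finset.mul_sum, h2] at hsum
  have h3 : 16 * σ ^ 3 * (2 ^ n * (σ / 2)) ≤
      16 * σ ^ 3 * ∑ ε : Fin n → Bool, |∑ a, boolSign (ε a) * w a| := by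
    have : (0 : ℝ) ≤ 2 ^ n * σ ^ 4 := by positivity
    nlinarith
  exact le_of_mul_le_mul_left h3 (by positivity)

/-! ### Rounding vector solutions to a single direction -/

theorem sum_abs_inner_le_norm_mul {k d : ℕ} {Z : Fin k → EuclideanSpace ℝ (Fin d)} {S : ℝ}
    (hS : ∀ v : EuclideanSpace ℝ (Fin d), ‖v‖ ≤ 1 → ∑ i, |inner ℝ v (Z i)| ≤ S)
    (v : EuclideanSpace ℝ (Fin d)) : ∑ i, |inner ℝ v (Z i)| ≤ ‖v‖ * S := by
  rcases eq_or_ne v 0 with rfl | hv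
  · simp
  have hv' : 0 < ‖v‖ := norm_pos_iff.2 hv
  have h := hS (‖v‖⁻¹ • v) (by rw [norm_smul]; simp [hv'.ne'])
  simp only [inner_smul_left, abs_mul, ← Finset.mul_sum] at h
  simp only [map_inv₀, conj_trivial, abs_inv, abs_norm] at h
  rwa [inv_mul_le_iff₀ hv'] at h

/-- Rounding: a Hilbert-Schmidt operator of norm one is replaced by a unit functional. -/
theorem sum_norm_le_two_mul {k d n : ℕ} {Z : Fin k → EuclideanSpace ℝ (Fin d)} {S : ℝ}
    (hS : ∀ v : EuclideanSpace ℝ (Fin d), ‖v‖ ≤ 1 → ∑ i, |inner ℝ v (Z i)| ≤ S)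
    (p : Fin d → EuclideanSpace ℝ (Fin n)) (hp : ∑ j, ‖p j‖ ^ 2 = 1) :
    ∑ i, ‖∑ j, Z i j • p j‖ ≤ 2 * S := by
  have hS0 : 0 ≤ S := (Finset.sum_nonneg fun _ _ => abs_nonneg _).trans (hS 0 (by simp))
  -- The vectors `p j` are the columns of an `n × d` matrix; a random signed sum of its rows is a
  -- random direction whose mean squared norm is 1.
  let row : Fin n → EuclideanSpace ℝ (Fin d) := fun a => WithLp.toLp 2 fun j => p j a
  let v : (Fin n → Bool) → EuclideanSpace ℝ (Fin d) := fun ε => ∑ a, boolSign (ε a) • row a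
  have hrow : ∑ a, ‖row a‖ ^ 2 = 1 := by
    rw [← hp]
    simp only [EuclideanSpace.norm_sq_eq, row]
    exact Finset.sum_comm
  have hv : ∀ ε i, inner ℝ (v ε) (Z i) = ∑ a, boolSign (ε a) * (∑ j, Z i j • p j) a := by
    intro ε i
    simp only [v, sum_inner, inner_smul_left, conj_trivial]
    refine Finset.sum_congr rfl fun a _ => ?_
    congr 1
    simp [row, PiLp.inner_apply]
  have h1 : ∑ ε : Fin n → Bool, ∑ i, |inner ℝ (v ε) (Z i)| ≤ 2 ^ n * S := by
    calc ∑ ε : Fin n → Bool, ∑ i, |inner ℝ (v ε) (Z i)|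
        -- `‖v‖ ≤ (1 + ‖v‖²) / 2` reduces the average of `‖v ε‖` to the known second moment.
        ≤ ∑ ε : Fin n → Bool, (1 / 2 + ‖v ε‖ ^ 2 / 2) * S := by
          refine Finset.sum_le_sum fun ε _ => (sum_abs_inner_le_norm_mul hS _).trans ?_
          gcongr
          nlinarith [sq_nonneg (‖v ε‖ - 1)]
      _ = 2 ^ n * S := by
          rw [← Finset.sum_mul, Finset.sum_add_distrib, ← Finset.sum_div _ fun ε => ‖v ε‖ ^ 2,
            sum_sign_norm_sq, hrow]
          simp only [Finset.sum_const, Finset.card_univ, Fintype.card_fun, Fintype.card_bool,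
            Fintype.card_fin, nsmul_eq_mul]
          push_cast
          ring
  have h2 : 2 ^ n * (∑ i, ‖∑ j, Z i j • p j‖ / 2) ≤ 2 ^ n * S := by
    refine le_trans ?_ h1
    rw [Finset.sum_comm, Finset.mul_sum]
    refine Finset.sum_le_sum fun i _ => ?_
    simp only [hv]
    exact sum_sign_abs_ge _
  have h3 := le_of_mul_le_mul_left h2 (by positivity)
  rw [← Finset.sum_div] at h3
  linarith

/-! ### Deterministic bounds on the semidefinite program -/

instance MTIndex.instFintype (k d : ℕ) : Fintype (MTIndex k d) :=
  Fintype.ofEquiv (Option (Fin k ⊕ Fin d))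
    { toFun := fun o => match o with
        | none => .one
        | some (.inl i) => .b i
        | some (.inr j) => .v j
      invFun := fun a => match a with
        | .one => none
        | .b i => some (.inl i)
        | .v j => some (.inr j)
      left_inv := by rintro (_ | _ | _) <;> rfl
      right_inv := by rintro (_ | _ | _) <;> rfl }

/-- A positive semidefinite matrix is a Gram matrix. -/
theorem Matrix.PosSemidef.exists_eq_inner {ι : Type*} [Fintype ι] {X : Matrix ι ι ℝ}
    (hX : X.PosSemidef) :
    ∃ u : ι → EuclideanSpace ℝ (Fin (Fintype.card ι)), ∀ a c, X a c = inner ℝ (u a) (u c) := by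
  classical
  open scoped MatrixOrder in
  obtain ⟨B, hB⟩ := CStarAlgebra.nonneg_iff_eq_star_mul_self.1 hX.nonneg
  refine ⟨fun a => WithLp.toLp 2 fun l => B ((Fintype.equivFin ι).symm l) a, fun a c => ?_⟩
  rw [hB, PiLp.inner_apply]
  simp only [Matrix.mul_apply, Matrix.star_apply, star_trivial]
  rw [← (Fintype.equivFin ι).symm.sum_comp]
  exact Finset.sum_congr rfl fun _ _ => by simp [mul_comm]

theorem mtFeasible_sub_iff {k d : ℕ} (x : EuclideanSpace ℝ (Fin d)) (r : ℝ)
    (Z : Fin k → EuclideanSpace ℝ (Fin d)) (X : Matrix (MTIndex k d) (MTIndex k d) ℝ) :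
    MTFeasible x r Z X ↔ MTFeasible 0 r (fun i => Z i - x) X :=
  ⟨fun h => ⟨h.1, h.2, h.3, h.4, by simpa using h.5⟩,
    fun h => ⟨h.1, h.2, h.3, h.4, by simpa using h.5⟩⟩

theorem mtValue_eq_sub {k d : ℕ} (x : EuclideanSpace ℝ (Fin d)) (r : ℝ)
    (Z : Fin k → EuclideanSpace ℝ (Fin d)) :
    mtValue x r Z = mtValue 0 r fun i => Z i - x := by
  simp only [mtValue, mtFeasible_sub_iff x r Z]

/-- Centering each `u_b` at `u_1 / 2` separates a linear part, in which the samples add up to `∑ Z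
i`, from a remainder of norm 1/2, which rounding controls. -/
theorem MTFeasible.mul_objective_le {k d : ℕ} {r : ℝ} {Z : Fin k → EuclideanSpace ℝ (Fin d)}
    {X : Matrix (MTIndex k d) (MTIndex k d) ℝ} (hX : MTFeasible 0 r Z X) {S : ℝ}
    (hS : ∀ v : EuclideanSpace ℝ (Fin d), ‖v‖ ≤ 1 → ∑ i, |inner ℝ v (Z i)| ≤ S) :
    mtObjective X * r ≤ ‖∑ i, Z i‖ / 2 + S := by
  obtain ⟨u, hu⟩ := hX.posSemidef.exists_eq_inner
  have hone : ‖u .one‖ = 1 := by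
    have := hX.one_one
    rw [hu, real_inner_self_eq_norm_sq] at this
    nlinarith [norm_nonneg (u .one)]
  have htr : ∑ j, ‖u (.v j)‖ ^ 2 = 1 := by
    rw [← hX.trace_v]
    exact Finset.sum_congr rfl fun j _ => by rw [hu, real_inner_self_eq_norm_sq]
  let q : Fin k → EuclideanSpace ℝ (Fin (Fintype.card (MTIndex k d))) :=
    fun i => ∑ j, Z i j • u (.v j)
  have hw : ∀ i, ‖u (.b i) - (1 / 2 : ℝ) • u .one‖ = 1 / 2 := by
    intro i
    have h := hX.diag_b i
    rw [hu, hu, real_inner_self_eq_norm_sq] at h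
    have : ‖u (.b i) - (1 / 2 : ℝ) • u .one‖ ^ 2 = (1 / 2) ^ 2 := by
      rw [norm_sub_sq_real, inner_smul_right, norm_smul, hone, h, real_inner_comm]
      norm_num
      ring
    exact (pow_left_inj₀ (norm_nonneg _) (by norm_num) two_ne_zero).1 this
  have hb : ∀ i, X .one (.b i) * r ≤ inner ℝ (u .one) (q i) / 2 + ‖q i‖ / 2 := by
    intro i
    have h := hX.inner_ge i
    rw [hX.diag_b] at h
    have h1 : ∑ j, X (.b i) (.v j) * (Z i j - (0 : EuclideanSpace ℝ (Fin d)) j)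
        = inner ℝ (u (.b i)) (q i) := by
      simp only [q, inner_sum, inner_smul_right, hu]
      exact Finset.sum_congr rfl fun j _ => by simp [mul_comm]
    have h2 : inner ℝ (u (.b i)) (q i) = inner ℝ (u .one) (q i) / 2
        + inner ℝ (u (.b i) - (1 / 2 : ℝ) • u .one) (q i) := by
      rw [inner_sub_left, inner_smul_left]
      simp; ring
    have h3 := real_inner_le_norm (u (.b i) - (1 / 2 : ℝ) • u .one) (q i)
    rw [hw] at h3
    rw [h1, h2] at h
    linarith
  have hq : ∑ i, q i = ∑ j, (∑ i, Z i) j • u (.v j) := by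
    simp only [q]
    rw [Finset.sum_comm]
    refine Finset.sum_congr rfl fun j _ => ?_
    rw [← Finset.sum_smul]
    simp
  -- Cauchy–Schwarz over the coordinates; the trace constraint makes the second factor 1.
  have hmean : inner ℝ (u .one) (∑ i, q i) ≤ ‖∑ i, Z i‖ := by
    calc inner ℝ (u .one) (∑ i, q i) ≤ ‖u .one‖ * ‖∑ i, q i‖ := real_inner_le_norm _ _
      _ = ‖∑ i, q i‖ := by rw [hone, one_mul]
      _ ≤ ∑ j, ‖(∑ i, Z i) j‖ * ‖u (.v j)‖ := by
        rw [hq]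
        exact (norm_sum_le _ _).trans (le_of_eq (by simp only [norm_smul]))
      _ ≤ √(∑ j, ‖(∑ i, Z i) j‖ ^ 2) * √(∑ j, ‖u (.v j)‖ ^ 2) :=
        Real.sum_mul_le_sqrt_mul_sqrt _ _ _
      _ = ‖∑ i, Z i‖ := by rw [htr, EuclideanSpace.norm_eq]; simp
  have hround := sum_norm_le_two_mul hS (fun j => u (.v j)) htr
  calc mtObjective X * r = ∑ i, X .one (.b i) * r := Finset.sum_mul _ _ _
    _ ≤ ∑ i, (inner ℝ (u .one) (q i) / 2 + ‖q i‖ / 2) := Finset.sum_le_sum fun i _ => hb i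
    _ = inner ℝ (u .one) (∑ i, q i) / 2 + (∑ i, ‖q i‖) / 2 := by
      rw [Finset.sum_add_distrib, ← Finset.sum_div, ← Finset.sum_div, inner_sum]
    _ ≤ ‖∑ i, Z i‖ / 2 + S := by
      have : ∑ i, ‖q i‖ ≤ 2 * S := hround
      linarith

/-- All Gram vectors have norm at most one. This supplies both the bound on the objective and the
compactness of the feasible set. -/
theorem MTFeasible.abs_le_one {k d : ℕ} {x : EuclideanSpace ℝ (Fin d)} {r : ℝ}
    {Z : Fin k → EuclideanSpace ℝ (Fin d)}
    {X : Matrix (MTIndex k d) (MTIndex k d) ℝ} (hX : MTFeasible x r Z X) (a c : MTIndex k d) :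
    |X a c| ≤ 1 := by
  obtain ⟨u, hu⟩ := hX.posSemidef.exists_eq_inner
  have hone : ‖u .one‖ = 1 := by
    have := hX.one_one
    rw [hu, real_inner_self_eq_norm_sq] at this
    nlinarith [norm_nonneg (u .one)]
  have hn : ∀ a, ‖u a‖ ≤ 1 := by
    rintro (_ | i | j)
    · exact hone.le
    · have h := hX.diag_b i
      rw [hu, hu, real_inner_self_eq_norm_sq] at h
      have h2 := real_inner_le_norm (u .one) (u (.b i))
      rw [hone, one_mul, ← h] at h2
      nlinarith [norm_nonneg (u (.b i))]
    · have h := hX.trace_v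
      simp only [hu, real_inner_self_eq_norm_sq] at h
      have h2 := Finset.single_le_sum (f := fun j => ‖u (.v j)‖ ^ 2)
        (fun j _ => sq_nonneg _) (Finset.mem_univ j)
      simp only [h] at h2
      exact (sq_le_one_iff₀ (norm_nonneg _)).1 h2
  rw [hu]
  exact (abs_real_inner_le_norm _ _).trans (mul_le_one₀ (hn a) (norm_nonneg _) (hn c))

theorem mtValue_le_update_add_one {k d : ℕ} (hd : 0 < d) (x : EuclideanSpace ℝ (Fin d)) (r : ℝ)
    (Z : Fin k → EuclideanSpace ℝ (Fin d)) (i : Fin k) (y : EuclideanSpace ℝ (Fin d)) :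
    mtValue x r Z ≤ mtValue x r (Function.update Z i y) + 1 := by
  classical
  refine csSup_le (mt_nonempty hd x r Z) ?_
  rintro _ ⟨X, hX, rfl⟩
  obtain ⟨u, hu⟩ := hX.posSemidef.exists_eq_inner
  -- Replacing the Gram vector of `b i` by 0 makes constraint `i` trivial for any new sample and
  -- loses only `X_{1,b_i} ≤ 1` in the objective.
  let u' := fun a : MTIndex k d => if a = .b i then 0 else u a
  have hX' : MTFeasible x r (Function.update Z i y) (Matrix.gram ℝ u') := by
    refine ⟨Matrix.posSemidef_gram ℝ u', ?_, ?_, ?_, ?_⟩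
    · simp [Matrix.gram_apply, u', ← hX.one_one, hu]
    · intro l
      by_cases hl : l = i
      · simp [Matrix.gram_apply, u', hl]
      · have := hX.diag_b l
        rw [hu, hu] at this
        simp only [Matrix.gram_apply, u', MTIndex.b.injEq, hl, if_false, reduceCtorEq, this]
    · have := hX.trace_v
      simp only [hu] at this
      simpa [Matrix.gram_apply, u'] using this
    · intro l
      by_cases hl : l = i
      · simp [Matrix.gram_apply, u', hl]
      · have := hX.inner_ge l
        simp only [hu] at this
        simp only [Matrix.gram_apply, u', MTIndex.b.injEq, hl, if_false, reduceCtorEq,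
          Function.update_of_ne (Ne.intro hl)]
        exact this
  have h1 : mtObjective X ≤ mtObjective (Matrix.gram ℝ u') + 1 := by
    unfold mtObjective
    rw [← Finset.add_sum_erase _ _ (Finset.mem_univ i),
      ← Finset.add_sum_erase (a := i) _ (fun l => Matrix.gram ℝ u' .one (.b l)) (Finset.mem_univ i)]
    have h2 : ∑ l ∈ Finset.univ.erase i, X .one (.b l)
        = ∑ l ∈ Finset.univ.erase i, Matrix.gram ℝ u' .one (.b l) := by
      refine Finset.sum_congr rfl fun l hl => ?_
      simp [Matrix.gram_apply, u', Finset.ne_of_mem_erase hl, hu]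
    have h3 : Matrix.gram ℝ u' .one (.b i) = 0 := by simp [Matrix.gram_apply, u']
    have h4 := (abs_le.1 (hX.abs_le_one .one (.b i))).2
    rw [h2, h3]
    linarith
  have h5 : mtObjective (Matrix.gram ℝ u') ≤ mtValue x r (Function.update Z i y) :=
    le_csSup (mt_bddAbove x r _) ⟨_, hX', rfl⟩
  linarith

theorem mtObjective_nonneg {k d : ℕ} {x : EuclideanSpace ℝ (Fin d)} {r : ℝ}
    {Z : Fin k → EuclideanSpace ℝ (Fin d)}
    {X : Matrix (MTIndex k d) (MTIndex k d) ℝ} (hX : MTFeasible x r Z X) : 0 ≤ mtObjective X :=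
  Finset.sum_nonneg fun i _ => by
    rw [← hX.diag_b]
    exact hX.posSemidef.diag_nonneg

theorem abs_mtValue_le {k d : ℕ} (hd : 0 < d) (x : EuclideanSpace ℝ (Fin d)) (r : ℝ)
    (Z : Fin k → EuclideanSpace ℝ (Fin d)) : |mtValue x r Z| ≤ k := by
  have hne := mt_nonempty hd x r Z
  unfold mtValue
  rw [abs_of_nonneg (Real.sSup_nonneg (by rintro _ ⟨X, hX, rfl⟩; exact mtObjective_nonneg hX))]
  refine csSup_le hne ?_
  rintro _ ⟨X, hX, rfl⟩
  calc mtObjective X ≤ ∑ _i : Fin k, (1 : ℝ) :=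
        Finset.sum_le_sum fun i _ => (abs_le.1 (hX.abs_le_one .one (.b i))).2
    _ = k := by simp

/-! ### Measurability of the optimal value -/

theorem isClosed_mtFeasible {k d : ℕ} (x : EuclideanSpace ℝ (Fin d)) (r : ℝ) :
    IsClosed {p : (Fin k → EuclideanSpace ℝ (Fin d)) × Matrix (MTIndex k d) (MTIndex k d) ℝ |
      MTFeasible x r p.1 p.2} := by
  have hent : ∀ a c, Continuous fun p : (Fin k → EuclideanSpace ℝ (Fin d)) ×
      Matrix (MTIndex k d) (MTIndex k d) ℝ => p.2 a c := fun a c =>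
    (continuous_apply_apply a c).comp continuous_snd
  have h : {p : (Fin k → EuclideanSpace ℝ (Fin d)) × Matrix (MTIndex k d) (MTIndex k d) ℝ |
      MTFeasible x r p.1 p.2} = {p | (∀ a c, p.2 a c = p.2 c a) ∧
        (∀ y : MTIndex k d →₀ ℝ, 0 ≤ y.sum fun i yi => y.sum fun j yj => yi * p.2 i j * yj) ∧
        p.2 .one .one = 1 ∧ (∀ i, p.2 (.b i) (.b i) = p.2 .one (.b i)) ∧
        ∑ j, p.2 (.v j) (.v j) = 1 ∧
        ∀ i, p.2 (.b i) (.b i) * r ≤ ∑ j, p.2 (.b i) (.v j) * (p.1 i j - x j)} := by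
    ext p
    constructor
    · intro h
      exact ⟨fun a c => by simpa using (h.1.1.apply a c).symm, h.1.2, h.2, h.3, h.4, h.5⟩
    · rintro ⟨h1, h2, h3, h4, h5, h6⟩
      exact ⟨⟨Matrix.IsHermitian.ext fun a c => by simpa using h1 c a, h2⟩, h3, h4, h5, h6⟩
  rw [h]
  simp only [Set.ofPred_and, Set.ofPred_forall, Finsupp.sum]
  refine IsClosed.inter (isClosed_iInter fun a => isClosed_iInter fun c =>
    isClosed_eq (hent a c) (hent c a)) (IsClosed.inter (isClosed_iInter fun y =>
    isClosed_le continuous_const ?_) (IsClosed.inter (isClosed_eq (hent _ _) continuous_const)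
    (IsClosed.inter (isClosed_iInter fun i => isClosed_eq (hent _ _) (hent _ _))
    (IsClosed.inter (isClosed_eq ?_ continuous_const)
    (isClosed_iInter fun i => isClosed_le ((hent _ _).mul continuous_const) ?_)))))
  · exact continuous_finsetSum _ fun i _ => continuous_finsetSum _ fun j _ =>
      (continuous_const.mul (hent i j)).mul continuous_const
  · exact continuous_finsetSum _ fun j _ => hent _ _
  · exact continuous_finsetSum _ fun j _ => (hent _ _).mul (by fun_prop)

/-- The set of data with value at least `c` is the projection, along a compact box of matrices, of a
closed set of pairs. Attainment of the optimum makes the two sets equal. -/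
theorem upperSemicontinuous_mtValue {k d : ℕ} (hd : 0 < d) (x : EuclideanSpace ℝ (Fin d))
    (r : ℝ) : UpperSemicontinuous fun Z : Fin k → EuclideanSpace ℝ (Fin d) => mtValue x r Z := by
  rw [upperSemicontinuous_iff_isClosed_preimage]
  intro c
  let K : Set (Matrix (MTIndex k d) (MTIndex k d) ℝ) :=
    Set.univ.pi fun _ => Set.univ.pi fun _ => Set.Icc (-1) 1
  have hK : IsCompact K := isCompact_univ_pi fun _ => isCompact_univ_pi fun _ => isCompact_Icc
  have hcobj : Continuous fun X : Matrix (MTIndex k d) (MTIndex k d) ℝ => mtObjective X :=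
    continuous_finsetSum _ fun i _ => continuous_apply_apply _ _
  have hFK : ∀ Z X, MTFeasible x r Z X → X ∈ K := fun Z X hX a _ c _ =>
    abs_le.1 (hX.abs_le_one a c)
  have : CompactSpace K := isCompact_iff_compactSpace.1 hK
  have hclosed : IsClosed {p : (Fin k → EuclideanSpace ℝ (Fin d)) × K |
      MTFeasible x r p.1 p.2.1 ∧ c ≤ mtObjective p.2.1} := by
    refine IsClosed.inter ?_ (isClosed_le continuous_const
      (hcobj.comp (continuous_subtype_val.comp continuous_snd)))
    exact (isClosed_mtFeasible (k := k) x r).preimage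
      (f := fun p : (Fin k → EuclideanSpace ℝ (Fin d)) × K => (p.1, p.2.1)) (by fun_prop)
  convert isClosedMap_fst_of_compactSpace _ hclosed using 1
  ext Z
  simp only [Set.mem_preimage, Set.mem_Ici, Set.mem_image, Set.mem_ofPred_eq, Prod.exists,
    exists_and_right, exists_eq_right]
  constructor
  · intro hc
    have hcomp : IsCompact {X | MTFeasible x r Z X} := by
      refine hK.of_isClosed_subset ?_ fun X hX => hFK Z X hX
      exact (isClosed_mtFeasible (k := k) x r).preimage
        (f := fun X : Matrix (MTIndex k d) (MTIndex k d) ℝ => (Z, X)) (by fun_prop)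
    obtain ⟨X, hX, hXeq⟩ :=
      (hcomp.image hcobj).sSup_mem (mt_nonempty hd x r Z)
    exact ⟨⟨X, hFK Z X hX⟩, hX, hc.trans hXeq.ge⟩
  · rintro ⟨X, hX, hc⟩
    exact hc.trans (le_csSup (mt_bddAbove x r Z) ⟨X.1, hX, rfl⟩)

theorem measurable_mtValue {k d : ℕ} (hd : 0 < d) (x : EuclideanSpace ℝ (Fin d)) (r : ℝ) :
    Measurable fun Z : Fin k → EuclideanSpace ℝ (Fin d) => mtValue x r Z :=
  (upperSemicontinuous_mtValue hd x r).measurable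

/-! ### Suprema over the unit ball, symmetrization and contraction -/

/-- The supremum of a function over the closed unit ball. -/
noncomputable def ballSup {E : Type*} [NormedAddCommGroup E] (h : E → ℝ) : ℝ :=
  sSup (h '' Metric.closedBall 0 1)

section ballSup

variable {E : Type*} [NormedAddCommGroup E]

theorem ballSup_le {h : E → ℝ} {c : ℝ} (hc : ∀ v, ‖v‖ ≤ 1 → h v ≤ c) : ballSup h ≤ c := by
  refine csSup_le ⟨h 0, 0, by simp, rfl⟩ ?_
  rintro _ ⟨v, hv, rfl⟩
  exact hc v (by simpa using hv)

variable [ProperSpace E]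

theorem le_ballSup {h : E → ℝ} (hh : Continuous h) {v : E} (hv : ‖v‖ ≤ 1) : h v ≤ ballSup h :=
  le_csSup ((isCompact_closedBall 0 1).bddAbove_image hh.continuousOn)
    ⟨v, by simpa using hv, rfl⟩

/-- Compactness of the ball gives continuity in the parameter, hence measurability of an uncountable
supremum. -/
theorem continuous_ballSup {γ : Type*} [TopologicalSpace γ] {f : γ → E → ℝ}
    (hf : Continuous fun p : γ × E => f p.1 p.2) : Continuous fun x => ballSup (f x) :=
  (isCompact_closedBall 0 1).continuous_sSup hf

theorem abs_ballSup_le {h : E → ℝ} (hh : Continuous h) {c : ℝ}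
    (hc : ∀ v, ‖v‖ ≤ 1 → |h v| ≤ c) : |ballSup h| ≤ c :=
  abs_le.2 ⟨(abs_le.1 (hc 0 (by simp))).1.trans (le_ballSup hh (by simp)),
    ballSup_le fun v hv => (abs_le.1 (hc v hv)).2⟩

theorem exists_bound_of_continuous {g : E → ℝ} (hg : Continuous g) :
    ∃ c, ∀ v, ‖v‖ ≤ 1 → |g v| ≤ c := by
  obtain ⟨c, hc⟩ := (isCompact_closedBall (0 : E) 1).exists_bound_of_continuousOn hg.continuousOn
  exact ⟨c, fun v hv => hc v (by simpa using hv)⟩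

theorem integrable_ballSup {γ : Type*} [TopologicalSpace γ] [MeasurableSpace γ]
    [OpensMeasurableSpace γ] {ρ : Measure γ} [IsFiniteMeasure ρ] {f : γ → E → ℝ}
    (hf : Continuous fun p : γ × E => f p.1 p.2) {b : γ → ℝ} (hb : Integrable b ρ)
    (hfb : ∀ x v, ‖v‖ ≤ 1 → |f x v| ≤ b x) : Integrable (fun x => ballSup (f x)) ρ :=
  hb.mono' (continuous_ballSup hf).measurable.aestronglyMeasurable
    (ae_of_all _ fun x => abs_ballSup_le (by fun_prop) (hfb x))

end ballSup

theorem abs_inner_le_of_norm_le_one {E : Type*} [NormedAddCommGroup E] [InnerProductSpace ℝ E]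
    {v : E} (hv : ‖v‖ ≤ 1) (z : E) : |inner ℝ v z| ≤ ‖z‖ :=
  (abs_real_inner_le_norm v z).trans (mul_le_of_le_one_left (norm_nonneg _) hv)

section SymmLaw

variable {E : Type*} [NormedAddCommGroup E] [MeasurableSpace E] [BorelSpace E]

/-- The law of `ε • z`, where `z` has law `ν` and `ε` is an independent uniform sign. -/
noncomputable def symmLaw (ν : Measure E) : Measure E :=
  (2⁻¹ : ENNReal) • (ν + ν.map Neg.neg)

instance (ν : Measure E) [IsProbabilityMeasure ν] : IsProbabilityMeasure (symmLaw ν) := by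
  have : IsProbabilityMeasure (ν.map Neg.neg) :=
    Measure.isProbabilityMeasure_map measurable_neg.aemeasurable
  refine ⟨?_⟩
  simp only [symmLaw, Measure.smul_apply, Measure.add_apply, measure_univ, smul_eq_mul]
  rw [one_add_one_eq_two]
  exact ENNReal.inv_mul_cancel two_ne_zero ENNReal.ofNat_ne_top

theorem integrable_symmLaw {F : Type*} [NormedAddCommGroup F] {ν : Measure E}
    {f : E → F} (hf : Integrable f ν) (hf' : Integrable (fun z => f (-z)) ν) :
    Integrable f (symmLaw ν) := by
  refine Integrable.smul_measure (Integrable.add_measure hf ?_) (by simp)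
  exact (MeasurableEquiv.neg E).measurableEmbedding.integrable_map_iff.2 hf'

theorem integral_symmLaw {F : Type*} [NormedAddCommGroup F] [NormedSpace ℝ F] {ν : Measure E}
    {f : E → F} (hf : Integrable f ν) (hf' : Integrable (fun z => f (-z)) ν) :
    ∫ z, f z ∂(symmLaw ν) = (2⁻¹ : ℝ) • (∫ z, f z ∂ν + ∫ z, f (-z) ∂ν) := by
  have h1 : Integrable f (ν.map Neg.neg) :=
    (MeasurableEquiv.neg E).measurableEmbedding.integrable_map_iff.2 hf'
  have h2 : ∫ z, f z ∂(ν.map Neg.neg) = ∫ z, f (-z) ∂ν :=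
    (MeasurableEquiv.neg E).measurableEmbedding.integral_map _
  rw [symmLaw, integral_smul_measure, integral_add_measure hf h1, h2]
  simp

theorem integral_id_symmLaw [NormedSpace ℝ E] {ν : Measure E} (h : Integrable (fun z => z) ν) :
    ∫ z, z ∂(symmLaw ν) = 0 := by
  rw [integral_symmLaw h h.neg, integral_neg, add_neg_cancel, smul_zero]

theorem integral_norm_sq_symmLaw {ν : Measure E} (h : MemLp (fun z => z) 2 ν) :
    ∫ z, ‖z‖ ^ 2 ∂(symmLaw ν) = ∫ z, ‖z‖ ^ 2 ∂ν := by
  have h2 : Integrable (fun z => ‖z‖ ^ 2) ν := h.integrable_norm_pow two_ne_zero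
  rw [integral_symmLaw h2 (by simpa using h2)]
  simp only [norm_neg, smul_eq_mul]
  ring

end SymmLaw

section Symmetrization

variable {E : Type*} [NormedAddCommGroup E] [InnerProductSpace ℝ E] [FiniteDimensional ℝ E]
  [MeasurableSpace E] [BorelSpace E]

theorem memLp_id_symmLaw {ν : Measure E} (h : MemLp (fun z => z) 2 ν) :
    MemLp (fun z => z) 2 (symmLaw ν) := by
  have h2 : Integrable (fun z => ‖z‖ ^ 2) ν := h.integrable_norm_pow two_ne_zero
  exact (memLp_two_iff_integrable_sq_norm measurable_id.aestronglyMeasurable).2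
    (integrable_symmLaw h2 (by simpa using h2))

/-- The mean absolute value of a marginal. -/
noncomputable def absMarginal (ν : Measure E) (v : E) : ℝ := ∫ z, |inner ℝ v z| ∂ν

theorem continuous_absMarginal {ν : Measure E} (hν : Integrable (fun z => ‖z‖) ν) :
    Continuous (absMarginal ν) := by
  refine continuous_iff_continuousAt.2 fun v₀ => continuousAt_of_dominated
    (bound := fun z => (‖v₀‖ + 1) * ‖z‖) (.of_forall fun v => by fun_prop) ?_
    (hν.const_mul _) (ae_of_all _ fun z => by fun_prop)
  filter_upwards [Metric.ball_mem_nhds v₀ one_pos] with v hv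
  refine ae_of_all _ fun z => ?_
  rw [Real.norm_eq_abs, abs_abs]
  refine (abs_real_inner_le_norm v z).trans ?_
  gcongr
  rw [mem_ball_iff_norm] at hv
  linarith [norm_le_norm_add_norm_sub' v v₀]

/-- Symmetrization and contraction in one coordinate. -/
theorem integral_ballSup_add_abs_inner_le (ν : Measure E) [IsProbabilityMeasure ν]
    (hν : Integrable (fun z => ‖z‖) ν) {g : E → ℝ} (hg : Continuous g) :
    ∫ z, ballSup (fun v => g v + |inner ℝ v z|) ∂ν
      ≤ ∫ z, ballSup (fun v => g v + absMarginal ν v + 2 * inner ℝ v z) ∂(symmLaw ν) := by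
  have ha := continuous_absMarginal hν
  obtain ⟨cg, hcg⟩ := exists_bound_of_continuous hg
  obtain ⟨ca, hca⟩ := exists_bound_of_continuous ha
  set h : E → ℝ := fun v => g v + absMarginal ν v with hh
  have hhc : Continuous h := hg.add ha
  have hhb : ∀ v, ‖v‖ ≤ 1 → |h v| ≤ cg + ca := fun v hv =>
    (abs_add_le _ _).trans (add_le_add (hcg v hv) (hca v hv))
  let Q : E → ℝ := fun z => ballSup fun v => h v + 2 * inner ℝ v z
  -- The second component is an independent copy: its mean cancels the `absMarginal` contained in
  -- `h`.
  let D : E × E → ℝ := fun p => ballSup fun v => h v + (|inner ℝ v p.1| - |inner ℝ v p.2|)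
  have hQ : Integrable Q ν := by
    refine integrable_ballSup (b := fun z => cg + ca + 2 * ‖z‖) (by fun_prop) (by fun_prop) ?_
    intro z v hv
    refine (abs_add_le _ _).trans (add_le_add (hhb v hv) ?_)
    rw [abs_mul, abs_two]
    gcongr
    exact abs_inner_le_of_norm_le_one hv z
  have hQ' : Integrable (fun z => Q (-z)) ν := by
    refine integrable_ballSup (b := fun z => cg + ca + 2 * ‖z‖) (by fun_prop) (by fun_prop) ?_
    intro z v hv
    refine (abs_add_le _ _).trans (add_le_add (hhb v hv) ?_)
    rw [abs_mul, abs_two, inner_neg_right, abs_neg]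
    gcongr
    exact abs_inner_le_of_norm_le_one hv z
  have hD : Integrable D (ν.prod ν) := by
    refine integrable_ballSup (b := fun p : E × E => cg + ca + (‖p.1‖ + ‖p.2‖)) (by fun_prop)
      (((integrable_const _).add ((hν.comp_fst ν).add (hν.comp_snd ν)))) ?_
    intro p v hv
    refine (abs_add_le _ _).trans (add_le_add (hhb v hv) ((abs_sub _ _).trans ?_))
    rw [abs_abs, abs_abs]
    exact add_le_add (abs_inner_le_of_norm_le_one hv _) (abs_inner_le_of_norm_le_one hv _)
  have hD' : Integrable (fun p => D p.swap) (ν.prod ν) := hD.swap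
  have hL : Integrable (fun z => ballSup (fun v => g v + |inner ℝ v z|)) ν := by
    refine integrable_ballSup (b := fun z => cg + ‖z‖) (by fun_prop) (by fun_prop) ?_
    intro z v hv
    refine (abs_add_le _ _).trans (add_le_add (hcg v hv) ?_)
    rw [abs_abs]
    exact abs_inner_le_of_norm_le_one hv z
  have hm : ∀ v : E, Integrable (fun z => |inner ℝ v z|) ν := fun v =>
    (hν.const_mul ‖v‖).mono' (by fun_prop) (ae_of_all _ fun z => by
      simpa using abs_real_inner_le_norm v z)
  have h1 : ∫ z, ballSup (fun v => g v + |inner ℝ v z|) ∂ν ≤ ∫ p, D p ∂(ν.prod ν) := by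
    rw [integral_prod _ hD]
    have hsec : ∀ z, Integrable (fun y => D (z, y)) ν := by
      intro z
      refine integrable_ballSup (b := fun y => cg + ca + (‖z‖ + ‖y‖)) (by fun_prop)
        (by fun_prop) ?_
      intro y v hv
      refine (abs_add_le _ _).trans (add_le_add (hhb v hv) ((abs_sub _ _).trans ?_))
      rw [abs_abs, abs_abs]
      exact add_le_add (abs_inner_le_of_norm_le_one hv _) (abs_inner_le_of_norm_le_one hv _)
    refine integral_mono hL hD.integral_prod_left fun z => ballSup_le fun v hv => ?_
    calc g v + |inner ℝ v z| = ∫ y, (h v + (|inner ℝ v z| - |inner ℝ v y|)) ∂ν := by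
          have e : Integrable (fun y => |inner ℝ v z| - |inner ℝ v y|) ν :=
            (integrable_const _).sub (hm v)
          rw [integral_add (integrable_const _) e,
            integral_sub (integrable_const _) (hm v)]
          simp [hh, absMarginal]
      _ ≤ ∫ y, D (z, y) ∂ν := by
          refine integral_mono ((integrable_const _).add ((integrable_const _).sub (hm v)))
            (hsec z) fun y => ?_
          exact le_ballSup (h := fun v => h v + (|inner ℝ v z| - |inner ℝ v y|))
            (by fun_prop) hv
  have hpt : ∀ p : E × E, D p + D p.swap
      ≤ ((Q p.1 + Q (-p.1)) + (Q p.2 + Q (-p.2))) / 2 := by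
    -- Contraction: choose the sign of `z` that turns `⟨v, ±z⟩` into `|⟨v, z⟩|` and use the opposite
    -- sign for `w`, where the inner product is at least `-|⟨w, z⟩|`. Applying this to both copies
    -- with `v` and `w` exchanged bounds `D p + D p.swap`.
    have hkey : ∀ (z v w : E), ‖v‖ ≤ 1 → ‖w‖ ≤ 1 →
        h v + h w + 2 * (|inner ℝ v z| - |inner ℝ w z|) ≤ Q z + Q (-z) := by
      have hQle : ∀ (z v : E), ‖v‖ ≤ 1 → h v + 2 * inner ℝ v z ≤ Q z := fun z v hv =>
        le_ballSup (h := fun v => h v + 2 * inner ℝ v z) (by fun_prop) hv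
      intro z v w hv hw
      have e1 := hQle z v hv
      have e2 := hQle z w hw
      have e3 := hQle (-z) v hv
      have e4 := hQle (-z) w hw
      rw [inner_neg_right] at e3 e4
      rcases abs_cases (inner ℝ v z : ℝ) with ⟨h1, _⟩ | ⟨h1, _⟩ <;>
      rcases abs_cases (inner ℝ w z : ℝ) with ⟨h2, _⟩ | ⟨h2, _⟩ <;> rw [h1, h2] <;> linarith
    intro p
    rw [← le_sub_iff_add_le]
    refine ballSup_le fun v hv => ?_
    rw [le_sub_comm]
    refine ballSup_le fun w hw => ?_
    have e1 := hkey p.1 v w hv hw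
    have e2 := hkey p.2 w v hw hv
    simp only [Prod.fst_swap, Prod.snd_swap]
    linarith
  have hQsum : Integrable (fun z => Q z + Q (-z)) ν := hQ.add hQ'
  have h2 : 2 * ∫ p, D p ∂(ν.prod ν) ≤ ∫ z, (Q z + Q (-z)) ∂ν := by
    have e1 : ∫ p, D p.swap ∂(ν.prod ν) = ∫ p, D p ∂(ν.prod ν) := integral_prod_swap _
    calc 2 * ∫ p, D p ∂(ν.prod ν) = ∫ p, (D p + D p.swap) ∂(ν.prod ν) := by
          rw [integral_add hD hD', e1]; ring
      _ ≤ ∫ p : E × E, ((Q p.1 + Q (-p.1)) + (Q p.2 + Q (-p.2))) / 2 ∂(ν.prod ν) :=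
          integral_mono (hD.add hD') (((hQsum.comp_fst ν).add (hQsum.comp_snd ν)).div_const 2) hpt
      _ = ∫ z, (Q z + Q (-z)) ∂ν := by
          rw [integral_div, integral_add (hQsum.comp_fst ν) (hQsum.comp_snd ν),
            integral_fun_fst (fun z => Q z + Q (-z)), integral_fun_snd (fun z => Q z + Q (-z))]
          simp
  rw [integral_symmLaw hQ hQ', ← integral_add hQ hQ', smul_eq_mul]
  linarith

end Symmetrization

theorem integrable_eval_pi {E : Type*} [MeasurableSpace E] {n : ℕ} {ν : Fin n → Measure E}
    [∀ i, IsProbabilityMeasure (ν i)] {i : Fin n} {f : E → ℝ} (hf : Integrable f (ν i)) :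
    Integrable (fun z : Fin n → E => f (z i)) (Measure.pi ν) :=
  (measurePreserving_eval ν i).integrable_comp_of_integrable hf

theorem integrable_norm_symmLaw {E : Type*} [NormedAddCommGroup E] [MeasurableSpace E]
    [BorelSpace E] {ν : Measure E} (hν : Integrable (fun z => ‖z‖) ν) :
    Integrable (fun z => ‖z‖) (symmLaw ν) :=
  integrable_symmLaw hν (by simpa using hν)

theorem abs_inner_sum_le {E : Type*} [NormedAddCommGroup E] [InnerProductSpace ℝ E] {n : ℕ}
    {v : E} (hv : ‖v‖ ≤ 1) (z : Fin n → E) : |inner ℝ v (∑ i, z i)| ≤ ∑ i, ‖z i‖ :=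
  (abs_inner_le_of_norm_le_one hv _).trans (norm_sum_le _ _)

theorem sum_abs_inner_le {E : Type*} [NormedAddCommGroup E] [InnerProductSpace ℝ E] {n : ℕ}
    {v : E} (hv : ‖v‖ ≤ 1) (z : Fin n → E) :
    |(∑ i, |inner ℝ v (z i)|)| ≤ ∑ i, ‖z i‖ := by
  rw [abs_of_nonneg (Finset.sum_nonneg fun _ _ => abs_nonneg _)]
  exact Finset.sum_le_sum fun i _ => abs_inner_le_of_norm_le_one hv _

section Symmetrization

variable {E : Type*} [NormedAddCommGroup E] [InnerProductSpace ℝ E] [FiniteDimensional ℝ E]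
  [MeasurableSpace E] [BorelSpace E]

theorem integrable_ballSup_sum_abs_inner {n : ℕ} (ν : Fin n → Measure E)
    [∀ i, IsProbabilityMeasure (ν i)] (hν : ∀ i, Integrable (fun z => ‖z‖) (ν i)) {g : E → ℝ}
    (hg : Continuous g) :
    Integrable (fun z : Fin n → E => ballSup fun v => g v + ∑ i, |inner ℝ v (z i)|)
      (Measure.pi ν) := by
  obtain ⟨c, hc⟩ := exists_bound_of_continuous hg
  refine integrable_ballSup (b := fun z => c + ∑ i, ‖z i‖) (by fun_prop)
    ((integrable_const _).add (integrable_finsetSum _ fun i _ => integrable_eval_pi (hν i))) ?_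
  intro z v hv
  exact (abs_add_le _ _).trans (add_le_add (hc v hv) (sum_abs_inner_le hv z))

theorem integrable_ballSup_inner_sum {n : ℕ} (ν : Fin n → Measure E)
    [∀ i, IsProbabilityMeasure (ν i)] (hν : ∀ i, Integrable (fun z => ‖z‖) (ν i)) {g : E → ℝ}
    (hg : Continuous g) :
    Integrable (fun z : Fin n → E => ballSup fun v => g v + 2 * inner ℝ v (∑ i, z i))
      (Measure.pi ν) := by
  obtain ⟨c, hc⟩ := exists_bound_of_continuous hg
  refine integrable_ballSup (b := fun z => c + 2 * ∑ i, ‖z i‖) (by fun_prop)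
    ((integrable_const _).add
      ((integrable_finsetSum _ fun i _ => integrable_eval_pi (hν i)).const_mul _)) ?_
  intro z v hv
  refine (abs_add_le _ _).trans (add_le_add (hc v hv) ?_)
  rw [abs_mul, abs_two]
  gcongr
  exact abs_inner_sum_le hv z

/-- Symmetrization and contraction for the supremum of a sum of absolute marginals. -/
theorem integral_ballSup_sum_abs_inner_le {n : ℕ} (ν : Fin n → Measure E)
    [∀ i, IsProbabilityMeasure (ν i)] (hν : ∀ i, Integrable (fun z => ‖z‖) (ν i)) {g : E → ℝ}
    (hg : Continuous g) :
    ∫ z, ballSup (fun v => g v + ∑ i, |inner ℝ v (z i)|) ∂(Measure.pi ν)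
      ≤ ∫ z, ballSup (fun v => g v + ∑ i, absMarginal (ν i) v + 2 * inner ℝ v (∑ i, z i))
          ∂(Measure.pi fun i => symmLaw (ν i)) := by
  -- The function `g` must vary because it absorbs the terms of the coordinates held fixed.
  induction n generalizing g with
  | zero => simp
  | succ n ih =>
    set π : Measure (Fin n → E) := Measure.pi fun i => ν i.succ with hπ
    set π' : Measure (Fin n → E) := Measure.pi fun i => symmLaw (ν i.succ) with hπ'
    have hν' : ∀ i, Integrable (fun z => ‖z‖) (symmLaw (ν i)) := fun i =>
      integrable_norm_symmLaw (hν i)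
    have ha : ∀ i, Continuous (absMarginal (ν i)) := fun i => continuous_absMarginal (hν i)
    let A : E → ℝ := fun v => g v + ∑ i : Fin n, absMarginal (ν i.succ) v
    have hA : Continuous A := by fun_prop
    obtain ⟨c, hc⟩ := exists_bound_of_continuous hA
    have hI₁ := (integrable_ballSup_sum_abs_inner ν hν hg).pi_succ
    have hI₂ := (integrable_ballSup_inner_sum (fun i => symmLaw (ν i)) hν'
      (g := fun v => g v + ∑ i, absMarginal (ν i) v) (by fun_prop)).pi_succ
    -- Hybrid stage: coordinate 0 keeps its original law and absolute value, while the others are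
    -- already symmetrized.
    let M : E → (Fin n → E) → ℝ := fun y z =>
      ballSup fun v => A v + |inner ℝ v y| + 2 * inner ℝ v (∑ i, z i)
    have hM : Integrable (Function.uncurry M) ((ν 0).prod π') := by
      refine integrable_ballSup (f := fun (p : E × (Fin n → E)) v =>
        A v + |inner ℝ v p.1| + 2 * inner ℝ v (∑ i, p.2 i))
        (b := fun p : E × (Fin n → E) => c + ‖p.1‖ + 2 * ∑ i, ‖p.2 i‖) (by fun_prop) ?_ ?_
      · have e₁ : Integrable (fun z : Fin n → E => ∑ i, ‖z i‖) π' :=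
          integrable_finsetSum _ fun i _ => integrable_eval_pi (hν' i.succ)
        have e₂ : Integrable (fun p : E × (Fin n → E) => ∑ i, ‖p.2 i‖) ((ν 0).prod π') :=
          e₁.comp_snd (ν 0)
        have e₃ : Integrable (fun p : E × (Fin n → E) => ‖p.1‖) ((ν 0).prod π') :=
          (hν 0).comp_fst π'
        exact ((integrable_const c).add e₃).add (e₂.const_mul 2)
      · intro p v hv
        refine (abs_add_le _ _).trans (add_le_add ((abs_add_le _ _).trans
          (add_le_add (hc v hv) ?_)) ?_)
        · rw [abs_abs]
          exact abs_inner_le_of_norm_le_one hv _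
        · rw [abs_mul, abs_two]
          gcongr
          exact abs_inner_sum_le hv _
    rw [integral_pi_succ, integral_pi_succ, integral_prod _ hI₁, integral_prod_symm _ hI₂]
    calc _ ≤ ∫ y, ∫ z, M y z ∂π' ∂(ν 0) := by
          refine integral_mono hI₁.integral_prod_left hM.integral_prod_left fun y => ?_
          have := ih (fun i => ν i.succ) (fun i => hν i.succ)
            (g := fun v => g v + |inner ℝ v y|) (by fun_prop)
          simp only [Fin.sum_univ_succ, Fin.cons_zero, Fin.cons_succ, ← add_assoc]
          refine this.trans (le_of_eq ?_)
          refine integral_congr_ae (ae_of_all _ fun z => ?_)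
          simp only [M, A]
          congr 1
          funext v
          ring
      _ = ∫ z, ∫ y, M y z ∂(ν 0) ∂π' := integral_integral_swap hM
      _ ≤ _ := by
          refine integral_mono hM.integral_prod_right hI₂.integral_prod_right fun z => ?_
          have := integral_ballSup_add_abs_inner_le (ν 0) (hν 0)
            (g := fun v => A v + 2 * inner ℝ v (∑ i, z i)) (by fun_prop)
          refine Eq.trans_le ?_ (this.trans (le_of_eq ?_))
          · refine integral_congr_ae (ae_of_all _ fun y => ?_)
            simp only [M]
            congr 1
            funext v
            ring
          · refine integral_congr_ae (ae_of_all _ fun y => ?_)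
            simp only [A, Fin.sum_univ_succ, Fin.cons_zero, Fin.cons_succ, inner_add_right]
            congr 1
            funext v
            ring

end Symmetrization

/-! ### Second moments and the bound on the expected value -/

theorem memLp_sum_eval_pi {n d : ℕ} (ν : Fin n → Measure (EuclideanSpace ℝ (Fin d)))
    [∀ i, IsProbabilityMeasure (ν i)] (hν : ∀ i, MemLp (fun z => z) 2 (ν i)) :
    MemLp (fun z : Fin n → EuclideanSpace ℝ (Fin d) => ∑ i, z i) 2 (Measure.pi ν) :=
  memLp_finsetSum _ fun i _ => (hν i).comp_measurePreserving (measurePreserving_eval ν i)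

theorem MeasureTheory.MemLp.eval_euclidean {Ω : Type*} [MeasurableSpace Ω] {d : ℕ}
    {P : Measure Ω} {Y : Ω → EuclideanSpace ℝ (Fin d)} (hY : MemLp Y 2 P) (j : Fin d) :
    MemLp (fun ω => Y ω j) 2 P :=
  (EuclideanSpace.proj (𝕜 := ℝ) j : EuclideanSpace ℝ (Fin d) →L[ℝ] ℝ).comp_memLp' hY

theorem integral_eval_euclidean {Ω : Type*} [MeasurableSpace Ω] {d : ℕ}
    {P : Measure Ω} {Y : Ω → EuclideanSpace ℝ (Fin d)} (hY : Integrable Y P) (j : Fin d) :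
    ∫ ω, Y ω j ∂P = (∫ ω, Y ω ∂P) j :=
  (EuclideanSpace.proj (𝕜 := ℝ) j : EuclideanSpace ℝ (Fin d) →L[ℝ] ℝ).integral_comp_comm hY

theorem integral_norm_sub_mean_sq {Ω : Type*} [MeasurableSpace Ω] {d : ℕ} {P : Measure Ω}
    [IsProbabilityMeasure P] {Y : Ω → EuclideanSpace ℝ (Fin d)} (hY : MemLp Y 2 P)
    {μ : EuclideanSpace ℝ (Fin d)} (hμ : ∫ ω, Y ω ∂P = μ) :
    ∫ ω, ‖Y ω - μ‖ ^ 2 ∂P = ∑ j, Var[fun ω => Y ω j; P] := by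
  have hYi := hY.integrable one_le_two
  have h : ∀ j, ∫ ω, (Y ω j - μ j) ^ 2 ∂P = Var[fun ω => Y ω j; P] := fun j => by
    rw [variance_eq_integral (hY.eval_euclidean j).aemeasurable, integral_eval_euclidean hYi, hμ]
  simp only [← h]
  have hint : ∀ j, Integrable (fun ω => (Y ω j - μ j) ^ 2) P := fun j =>
    ((hY.eval_euclidean j).sub (memLp_const (μ j))).integrable_sq
  rw [← integral_finsetSum _ fun j _ => hint j]
  simp [EuclideanSpace.norm_sq_eq]

/-- In each coordinate the variances of independent summands add, and centering turns squared norms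
into sums of variances. -/
theorem integral_norm_sum_sq {n d : ℕ} (ν : Fin n → Measure (EuclideanSpace ℝ (Fin d)))
    [∀ i, IsProbabilityMeasure (ν i)] (hν : ∀ i, MemLp (fun z => z) 2 (ν i))
    (hν0 : ∀ i, ∫ z, z ∂(ν i) = 0) :
    ∫ z, ‖∑ i, z i‖ ^ 2 ∂(Measure.pi ν) = ∑ i, ∫ z, ‖z‖ ^ 2 ∂(ν i) := by
  have hsum := memLp_sum_eval_pi ν hν
  have hmean : ∫ z, ∑ i, z i ∂(Measure.pi ν) = 0 := by
    have hint : ∀ i, Integrable (fun z : Fin n → EuclideanSpace ℝ (Fin d) => z i)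
        (Measure.pi ν) := fun i =>
      (measurePreserving_eval ν i).integrable_comp_of_integrable ((hν i).integrable one_le_two)
    rw [integral_finsetSum _ fun i _ => hint i]
    refine Finset.sum_eq_zero fun i _ => ?_
    rw [← hν0 i, ← (measurePreserving_eval ν i).map_eq]
    exact (integral_map (f := fun z => z) (measurePreserving_eval ν i).measurable.aemeasurable
      measurable_id.aestronglyMeasurable).symm
  have h1 := integral_norm_sub_mean_sq hsum hmean
  have h2 : ∀ i, ∫ z, ‖z‖ ^ 2 ∂(ν i) = ∑ j, Var[fun z => z j; ν i] := fun i => by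
    simpa using integral_norm_sub_mean_sq (hν i) (hν0 i)
  simp only [sub_zero] at h1
  simp only [h1, h2]
  rw [Finset.sum_comm]
  refine Finset.sum_congr rfl fun j _ => ?_
  rw [← variance_sum_pi fun i => (hν i).eval_euclidean j]
  congr 1
  funext z
  simp

theorem integral_norm_le_sqrt {Ω E : Type*} [MeasurableSpace Ω] [NormedAddCommGroup E]
    {P : Measure Ω} [IsProbabilityMeasure P] {X : Ω → E} (hX : MemLp X 2 P) :
    ∫ ω, ‖X ω‖ ∂P ≤ √(∫ ω, ‖X ω‖ ^ 2 ∂P) := by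
  refine Real.le_sqrt_of_sq_le ?_
  have h := variance_nonneg (fun ω => ‖X ω‖) P
  rw [variance_eq_sub hX.norm] at h
  simpa using h

theorem integral_norm_sum_le {n d : ℕ} (ν : Fin n → Measure (EuclideanSpace ℝ (Fin d)))
    [∀ i, IsProbabilityMeasure (ν i)] (hν : ∀ i, MemLp (fun z => z) 2 (ν i))
    (hν0 : ∀ i, ∫ z, z ∂(ν i) = 0) :
    ∫ z, ‖∑ i, z i‖ ∂(Measure.pi ν) ≤ √(∑ i, ∫ z, ‖z‖ ^ 2 ∂(ν i)) := by
  rw [← integral_norm_sum_sq ν hν hν0]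
  exact integral_norm_le_sqrt (memLp_sum_eval_pi ν hν)

/-- The expectation of the value of the semidefinite program at centered independent vectors. -/
theorem integral_mtValue_mul_le {k d : ℕ} (hd : 0 < d)
    (ν : Fin k → Measure (EuclideanSpace ℝ (Fin d)))
    [∀ i, IsProbabilityMeasure (ν i)] (hν : ∀ i, MemLp (fun z => z) 2 (ν i))
    (hν0 : ∀ i, ∫ z, z ∂(ν i) = 0) {b : ℝ}
    (hb : ∀ i v, ‖v‖ ≤ 1 → absMarginal (ν i) v ≤ b) {r : ℝ} (hr : 0 < r) :
    (∫ z, mtValue 0 r z ∂(Measure.pi ν)) * r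
      ≤ k * b + 5 / 2 * √(∑ i, ∫ z, ‖z‖ ^ 2 ∂(ν i)) := by
  have hν1 : ∀ i, Integrable (fun z => ‖z‖) (ν i) := fun i =>
    ((hν i).integrable one_le_two).norm
  have hν1' : ∀ i, Integrable (fun z => ‖z‖) (symmLaw (ν i)) := fun i =>
    integrable_norm_symmLaw (hν1 i)
  have hν' : ∀ i, MemLp (fun z => z) 2 (symmLaw (ν i)) := fun i => memLp_id_symmLaw (hν i)
  have hsum := ((memLp_sum_eval_pi ν hν).integrable one_le_two).norm
  have hsum' := ((memLp_sum_eval_pi (fun i => symmLaw (ν i)) hν').integrable one_le_two).norm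
  have hsup := integrable_ballSup_sum_abs_inner ν hν1 (g := fun _ => 0) continuous_const
  have hsymm := integral_ballSup_sum_abs_inner_le ν hν1 (g := fun _ => 0) continuous_const
  simp only [zero_add] at hsup hsymm
  have hval : Integrable (fun z => mtValue 0 r z) (Measure.pi ν) :=
    .of_bound (measurable_mtValue hd 0 r).aestronglyMeasurable k
      (ae_of_all _ fun z => abs_mtValue_le hd 0 r z)
  have hpt : ∀ z : Fin k → EuclideanSpace ℝ (Fin d), mtValue 0 r z * r
      ≤ ‖∑ i, z i‖ / 2 + ballSup fun v => ∑ i, |inner ℝ v (z i)| := by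
    intro z
    rw [← le_div_iff₀ hr]
    refine csSup_le (mt_nonempty hd 0 r z) ?_
    rintro _ ⟨X, hX, rfl⟩
    rw [le_div_iff₀ hr]
    exact hX.mul_objective_le fun v hv =>
      le_ballSup (h := fun v => ∑ i, |inner ℝ v (z i)|) (by fun_prop) hv
  have hlin : ∫ z, ballSup (fun v => ∑ i, absMarginal (ν i) v + 2 * inner ℝ v (∑ i, z i))
      ∂(Measure.pi fun i => symmLaw (ν i)) ≤ k * b + 2 * √(∑ i, ∫ z, ‖z‖ ^ 2 ∂(ν i)) := by
    calc _ ≤ ∫ z, (k * b + 2 * ‖∑ i, z i‖) ∂(Measure.pi fun i => symmLaw (ν i)) := by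
          have ha : ∀ i, Continuous (absMarginal (ν i)) := fun i =>
            continuous_absMarginal (hν1 i)
          refine integral_mono (integrable_ballSup_inner_sum (fun i => symmLaw (ν i)) hν1'
            (g := fun v => ∑ i, absMarginal (ν i) v) (by fun_prop))
            ((integrable_const _).add (hsum'.const_mul 2)) fun z => ballSup_le fun v hv => ?_
          refine add_le_add ?_ ?_
          · calc ∑ i, absMarginal (ν i) v ≤ ∑ _i : Fin k, b :=
                  Finset.sum_le_sum fun i _ => hb i v hv
              _ = k * b := by simp
          · gcongr
            exact (le_abs_self _).trans (abs_inner_le_of_norm_le_one hv _)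
      _ = k * b + 2 * ∫ z, ‖∑ i, z i‖ ∂(Measure.pi fun i => symmLaw (ν i)) := by
          rw [integral_add (integrable_const _) (hsum'.const_mul 2),
            integral_const_mul 2 fun z : Fin k → EuclideanSpace ℝ (Fin d) => ‖∑ i, z i‖]
          simp
      _ ≤ k * b + 2 * √(∑ i, ∫ z, ‖z‖ ^ 2 ∂(symmLaw (ν i))) := by
          gcongr
          exact integral_norm_sum_le _ hν' fun i =>
            integral_id_symmLaw ((hν i).integrable one_le_two)
      _ = _ := by simp only [integral_norm_sq_symmLaw (hν _)]
  calc (∫ z, mtValue 0 r z ∂(Measure.pi ν)) * r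
      = ∫ z, mtValue 0 r z * r ∂(Measure.pi ν) := (integral_mul_const _ _).symm
    _ ≤ ∫ z, (‖∑ i, z i‖ / 2 + ballSup fun v => ∑ i, |inner ℝ v (z i)|) ∂(Measure.pi ν) :=
        integral_mono (hval.mul_const r) ((hsum.div_const 2).add hsup) hpt
    _ = (∫ z, ‖∑ i, z i‖ ∂(Measure.pi ν)) / 2
        + ∫ z, ballSup (fun v => ∑ i, |inner ℝ v (z i)|) ∂(Measure.pi ν) := by
        rw [integral_add (hsum.div_const 2) hsup, integral_div]
    -- `5 / 2` is 1/2 from the linear part plus 2 from the contracted supremum.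
    _ ≤ k * b + 5 / 2 * √(∑ i, ∫ z, ‖z‖ ^ 2 ∂(ν i)) := by
        linarith [integral_norm_sum_le ν hν hν0]

/-! ### Moment comparison and the final estimate -/

/-- Lyapunov's inequality between the first and a higher absolute moment. -/
theorem integral_abs_le_of_integral_rpow_le {Ω : Type*} [MeasurableSpace Ω] {P : Measure Ω}
    [IsProbabilityMeasure P] {X : Ω → ℝ} (hX : Integrable X P) {p β : ℝ} (hp : 1 ≤ p)
    (hXp : Integrable (fun ω => |X ω| ^ p) P) (hβ : ∫ ω, |X ω| ^ p ∂P ≤ β) :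
    ∫ ω, |X ω| ∂P ≤ β ^ (1 / p) := by
  have hp0 : 0 < p := by linarith
  have h0 : 0 ≤ ∫ ω, |X ω| ∂P := integral_nonneg fun _ => abs_nonneg _
  have h := (convexOn_rpow hp).map_integral_le (μ := P) (f := fun ω => |X ω|)
    (Real.continuous_rpow_const hp0.le).continuousOn isClosed_Ici
    (ae_of_all _ fun ω => Set.mem_Ici.2 (abs_nonneg _)) hX.abs hXp
  calc ∫ ω, |X ω| ∂P = ((∫ ω, |X ω| ∂P) ^ p) ^ (1 / p) := by
        rw [← Real.rpow_mul h0, mul_one_div_cancel hp0.ne', Real.rpow_one]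
    _ ≤ β ^ (1 / p) := by
        gcongr
        exact h.trans hβ

theorem mainTheorem2 {Ω : Type*} [MeasurableSpace Ω] (P : Measure Ω) [IsProbabilityMeasure P]
    (k d : ℕ) (hk : 0 < k) (hd : 0 < d)
    (Y : Fin k → Ω → EuclideanSpace ℝ (Fin d))
    (hindep : iIndepFun Y P)
    (hident : ∀ i j, IdentDistrib (Y i) (Y j) P P)
    (hL2 : ∀ i, MemLp (Y i) 2 P)
    (μ : EuclideanSpace ℝ (Fin d)) (hmean : ∀ i, ∫ ω, Y i ω ∂P = μ)
    (Λ : Matrix (Fin d) (Fin d) ℝ) (hcov : ∀ i, covMatrix (Y i) P = Λ)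
    (α : ℝ) (hα : 0 ≤ α) (β : ℝ)
    (hmoment : ∀ i, ∀ v : EuclideanSpace ℝ (Fin d), ‖v‖ = 1 →
      Integrable (fun ω => |inner ℝ v (Y i ω - μ)| ^ (1 + α)) P ∧
        ∫ ω, |inner ℝ v (Y i ω - μ)| ^ (1 + α) ∂P ≤ β)
    (r : ℝ) (hr0 : 0 < r)
    (hr : 100 * Real.sqrt (Λ.trace / k) + 40 * β ^ (1 / (1 + α)) ≤ r) :
    1 - Real.exp (-(k : ℝ) / 800) ≤ P.real {ω | mtValue μ r (fun i => Y i ω) ≤ (k : ℝ) / 20} := by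

  have hk' : (0 : ℝ) < k := by exact_mod_cast hk
  have hYm : ∀ i, AEMeasurable (fun ω => Y i ω - μ) P := fun i =>
    (hL2 i).aestronglyMeasurable.aemeasurable.sub_const μ
  have hYμ : ∀ i, MemLp (fun ω => Y i ω - μ) 2 P := fun i => (hL2 i).sub (memLp_const μ)
  let ν : Fin k → Measure (EuclideanSpace ℝ (Fin d)) := fun i => P.map fun ω => Y i ω - μ
  have hνP : ∀ i, IsProbabilityMeasure (ν i) := fun i => Measure.isProbabilityMeasure_map (hYm i)
  have hmap : P.map (fun ω i => Y i ω - μ) = Measure.pi ν :=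
    (iIndepFun_iff_map_fun_eq_pi_map hYm).1
      (hindep.comp (fun _ y => y - μ) fun _ => measurable_id.sub_const μ)
  have hν : ∀ i, MemLp (fun z => z) 2 (ν i) := fun i =>
    (memLp_map_measure_iff measurable_id.aestronglyMeasurable (hYm i)).2 (hYμ i)
  have hν0 : ∀ i, ∫ z, z ∂(ν i) = 0 := fun i => by
    rw [integral_map (f := fun z => z) (hYm i) measurable_id.aestronglyMeasurable,
      integral_sub ((hL2 i).integrable one_le_two) (integrable_const _), hmean i]
    simp
  have hsq : ∀ i, ∫ z, ‖z‖ ^ 2 ∂(ν i) = Λ.trace := fun i => by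
    rw [integral_map (hYm i) (by fun_prop), integral_norm_sub_mean_sq (hL2 i) (hmean i),
      ← hcov i]
    refine Finset.sum_congr rfl fun j _ => ?_
    exact (covariance_self ((hL2 i).eval_euclidean j).aemeasurable).symm
  set b : ℝ := β ^ (1 / (1 + α))
  have hunit : ∀ i (v : EuclideanSpace ℝ (Fin d)), ‖v‖ = 1 → absMarginal (ν i) v ≤ b := by
    intro i v hv
    rw [absMarginal, integral_map (hYm i) (by fun_prop)]
    exact integral_abs_le_of_integral_rpow_le
      (((hYμ i).integrable one_le_two).const_inner v) (by linarith)
      (hmoment i v hv).1 (hmoment i v hv).2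
  have hb : ∀ i (v : EuclideanSpace ℝ (Fin d)), ‖v‖ ≤ 1 → absMarginal (ν i) v ≤ b := by
    intro i v hv
    -- The sign of `β` is not assumed; a unit vector exists since `0 < d`, and its marginal forces
    -- `b ≥ 0`.
    have hb0 : 0 ≤ b := by
      have := hunit i (EuclideanSpace.single ⟨0, hd⟩ 1) (by simp)
      exact le_trans (integral_nonneg fun _ => abs_nonneg _) this
    rcases eq_or_ne v 0 with rfl | hv0
    · simpa [absMarginal] using hb0
    have hv' : 0 < ‖v‖ := norm_pos_iff.2 hv0
    have h1 : absMarginal (ν i) v = ‖v‖ * absMarginal (ν i) (‖v‖⁻¹ • v) := by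
      simp only [absMarginal, inner_smul_left, abs_mul, map_inv₀, conj_trivial, abs_inv, abs_norm,
        integral_const_mul]
      field_simp
    rw [h1]
    have h2 := hunit i (‖v‖⁻¹ • v) (by rw [norm_smul]; simp [hv'.ne'])
    calc ‖v‖ * absMarginal (ν i) (‖v‖⁻¹ • v) ≤ ‖v‖ * b := by gcongr
      _ ≤ 1 * b := by gcongr
      _ = b := one_mul b
  have hE : ∫ z, mtValue 0 r z ∂(Measure.pi ν) ≤ k / 40 := by
    have h := integral_mtValue_mul_le hd ν hν hν0 hb hr0
    simp only [hsq, Finset.sum_const, Finset.card_univ, Fintype.card_fin, nsmul_eq_mul] at h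
    have hs : √(k * Λ.trace) = k * √(Λ.trace / k) := by
      have : (k : ℝ) * Λ.trace = k ^ 2 * (Λ.trace / k) := by field_simp
      rw [this, Real.sqrt_mul (by positivity), Real.sqrt_sq hk'.le]
    rw [hs] at h
    refine le_of_mul_le_mul_right (h.trans ?_) hr0
    -- The bound is `k (b + 5/2 √(Tr Λ / k))`, and `40 * (5/2) = 100`, so the hypothesis on `r`
    -- gives exactly `k r / 40`.
    nlinarith
  have hmeas := measurable_mtValue (k := k) hd 0 r
  -- The budget `k / 20` is split equally between mean and deviation.
  have hdev := measure_ge_le_of_bounded_differences hk ν (fun z => mtValue 0 r z) hmeas k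
    (abs_mtValue_le hd 0 r) (mtValue_le_update_add_one hd 0 r) (s := k / 40) (by positivity)
  have hexp : -2 * ((k : ℝ) / 40) ^ 2 / k = -(k : ℝ) / 800 := by field_simp; norm_num
  rw [hexp] at hdev
  have hset : MeasurableSet {z : Fin k → EuclideanSpace ℝ (Fin d) | mtValue 0 r z ≤ (k : ℝ) / 20} :=
    measurableSet_le hmeas measurable_const
  have hpre : P.real {ω | mtValue μ r (fun i => Y i ω) ≤ (k : ℝ) / 20}
      = (Measure.pi ν).real {z | mtValue 0 r z ≤ (k : ℝ) / 20} := by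
    rw [← hmap, map_measureReal_apply_of_aemeasurable (aemeasurable_pi_lambda _ hYm) hset]
    simp only [mtValue_eq_sub μ]
    rfl
  rw [hpre]
  have hcompl := probReal_compl_eq_one_sub (μ := Measure.pi ν) hset
  have hle : (Measure.pi ν).real {z | mtValue 0 r z ≤ (k : ℝ) / 20}ᶜ
      ≤ Real.exp (-(k : ℝ) / 800) := by
    refine (measureReal_mono fun z hz => ?_).trans hdev
    simp only [Set.mem_compl_iff, Set.mem_ofPred_eq, not_le] at hz ⊢
    linarith
  linarith
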